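/- All topological spaces are assumed to be Tychonoff. A topological group $G$ is $\omega$-narrow if for every neighbourhood $U$ of the identity there is a countable set $S\subseteq G$ with $SU=G$. An action of a topological group $G$ on a space $X$ is continuous if the map $G\times X\to X$ is continuous. A space $X$ is homogeneous if for all $x,y\in X$ there is a homeomorphism of $X$ onto itself taking $x$ to $y$, and it has the Baire property if every countable intersection of dense open subsets of $X$ is dense. A coset space is a space homeomorphic to a quotient space $G/H$ of a topological group $G$ by a subgroup $H$. **Corollary 4.11.** Let $X$ be a homogeneous first-countable space with the Baire property. If some $\omega$-narrow topological group acts continuously and transitively on $X$, then $X$ is separable and metrizable. Consequently, no $\omega$-narrow topological group acts continuously and transitively on any of the following spaces: 1. the Sorgenfrey line, i.e. $\mathbb R$ with the topology generated by the intervals $[a,b)$; 2. the two-arrows space, i.e. the set $\{(x,0):0<x\le 1\}\cup\{(x,1):0\le x<1\}$ with the order topology of the lexicographic order; 3. any nonempty homogeneous first-countable compact Hausdorff space that is not a coset space (such as Fedorchuk's compactum). -/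

import Mathlib

open Set Topology
open scoped Pointwise

universe u v

/-- A topological group is `ω`-narrow if it is covered by countably many left translates of
any neighbourhood of the identity. -/
def IsOmegaNarrow (G : Type v) [Group G] [TopologicalSpace G] : Prop :=
  ∀ U ∈ 𝓝 (1 : G), ∃ S : Set G, S.Countable ∧ S * U = univ

/-- A space is homogeneous if its self-homeomorphisms act transitively on its points. -/
def IsHomogeneousSpace (X : Type u) [TopologicalSpace X] : Prop :=
  ∀ x y : X, ∃ h : X ≃ₜ X, h x = y

/-- The space `X` admits a (jointly) continuous transitive action of some `ω`-narrow
topological group. -/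
def AdmitsNarrowTransitiveAction (X : Type u) [TopologicalSpace X] : Prop :=
  ∃ (G : Type v) (_ : Group G) (_ : TopologicalSpace G) (_ : IsTopologicalGroup G)
    (_ : MulAction G X),
    IsOmegaNarrow G ∧ ContinuousSMul G X ∧ MulAction.IsPretransitive G X

/-- The space `X` is a coset space: it is homeomorphic to a quotient `G ⧸ H` (with the quotient
topology) of a topological group `G` by a subgroup `H`. Allowing `G` in other universes gives
nothing new, since the kernel of the action of `G` on `G ⧸ H` can be factored out. -/
def IsCosetSpace (X : Type u) [TopologicalSpace X] : Prop :=
  ∃ (G : Type u) (_ : Group G) (_ : TopologicalSpace G) (_ : IsTopologicalGroup G)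
    (H : Subgroup G), Nonempty (X ≃ₜ G ⧸ H)

/-- The Sorgenfrey line: the real numbers with the topology generated by the half-open
intervals `[a, b)`. -/
def SorgenfreyLine : Type := ℝ

instance : TopologicalSpace SorgenfreyLine :=
  TopologicalSpace.generateFrom {s : Set ℝ | ∃ a b : ℝ, s = Ico a b}

/-- The underlying set of the two-arrows space: the points `(x, 0)` with `0 < x ≤ 1` and
`(x, 1)` with `0 ≤ x < 1` (`false` stands for `0`, `true` for `1`). -/
def TwoArrows : Type :=
  {p : ℝ ×ₗ Bool // ((ofLex p).2 = false ∧ 0 < (ofLex p).1 ∧ (ofLex p).1 ≤ 1) ∨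
    ((ofLex p).2 = true ∧ 0 ≤ (ofLex p).1 ∧ (ofLex p).1 < 1)}

/-- The lexicographic order: `(x, i) < (y, j)` iff `x < y`, or `x = y` and `i = 0`, `j = 1`. -/
noncomputable instance : LinearOrder TwoArrows :=
  inferInstanceAs (LinearOrder {p : ℝ ×ₗ Bool //
    ((ofLex p).2 = false ∧ 0 < (ofLex p).1 ∧ (ofLex p).1 ≤ 1) ∨
    ((ofLex p).2 = true ∧ 0 ≤ (ofLex p).1 ∧ (ofLex p).1 < 1)})

/-- The two-arrows space carries the order topology of the lexicographic order. Equivalently, the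
sets `{(x, i) | a < x < b} ∪ {(b, 0)}` and `{(x, i) | a < x < b} ∪ {(a, 1)}` with
`0 ≤ a < b ≤ 1` form a base. -/
noncomputable instance : TopologicalSpace TwoArrows := Preorder.topology TwoArrows

/-! The key fact is that a continuous transitive action of an `ω`-narrow group `G` on a Baire space
is nearly open: `x` is interior to the closure of `U • x` for every neighbourhood `U` of `1`.
Indeed, countably many translates of a smaller `V` cover `G`, so by Baire some closure of `s • V •
x` has interior, which can be translated back to `x`. If `X` is also regular and first-countable,
shrinking `V` along a countable base at `x` and letting `s` range over countable sets yields a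
countable base of `X` (`IsOmegaNarrow.secondCountableTopology`); Urysohn's theorem then gives
metrizability.

The Sorgenfrey line and the two-arrows space are regular, first-countable and Baire, but not
second-countable. A homogeneous compact space satisfying the hypotheses becomes metrizable, so its
homeomorphism group is Polish and in particular `ω`-narrow. The action of that group is therefore
nearly open, and completeness upgrades this to open orbit maps, as in the open mapping theorem.
Hence the space is a coset space after all. -/

open TopologicalSpace

/-! ### Near openness and second countability. -/

section NearlyOpen

variable {G X : Type*} [Group G] [TopologicalSpace G] [TopologicalSpace X] [MulAction G X]
  [ContinuousSMul G X]

theorem smul_mem_interior_closure_image_smul {U : Set G} (g : G) {x y : X}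
    (h : y ∈ interior (closure ((· • x) '' U))) :
    g • y ∈ interior (closure ((· • x) '' (g • U))) := by
  have e : ((· • x) '' (g • U)) = g • ((· • x) '' U) := by
    ext z
    simp only [mem_image, mem_smul_set]
    constructor
    · rintro ⟨_, ⟨u, hu, rfl⟩, rfl⟩
      exact ⟨u • x, ⟨u, hu, rfl⟩, by simp [smul_smul]⟩
    · rintro ⟨_, ⟨u, hu, rfl⟩, rfl⟩
      exact ⟨g • u, ⟨u, hu, rfl⟩, by simp [smul_smul]⟩
  rw [e, closure_smul, interior_smul]
  exact smul_mem_smul_set h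

variable [IsTopologicalGroup G]

/-- A continuous transitive action of an `ω`-narrow group on a Baire space is nearly open. -/
theorem IsOmegaNarrow.mem_interior_closure_image_smul (hG : IsOmegaNarrow G) [BaireSpace X]
    [MulAction.IsPretransitive G X] {U : Set G} (hU : U ∈ 𝓝 1) (x : X) :
    x ∈ interior (closure ((· • x) '' U)) := by
  obtain ⟨V, hV, -, hVs, hVU⟩ := exists_closed_nhds_one_inv_eq_mul_subset hU
  obtain ⟨S, hSc, hS⟩ := hG V hV
  have : Nonempty X := ⟨x⟩
  have : Countable S := hSc.to_subtype
  obtain ⟨⟨s, hs⟩, z, hz⟩ : ∃ s : S, (interior (closure ((· • x) '' (s.1 • V)))).Nonempty := by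
    refine nonempty_interior_of_iUnion_of_closed (fun _ ↦ isClosed_closure) ?_
    refine eq_univ_iff_forall.2 fun y ↦ ?_
    obtain ⟨g, rfl⟩ := MulAction.exists_smul_eq G x y
    obtain ⟨s, hs, v, hv, rfl⟩ : g ∈ S * V := hS ▸ mem_univ g
    exact mem_iUnion.2 ⟨⟨s, hs⟩, subset_closure ⟨_, smul_mem_smul_set hv, rfl⟩⟩
  -- The interior point may be taken in the orbit piece itself, as `(s * v) • x`. Translating by `(s
  -- * v)⁻¹` sends it to `x` and turns `s • V` into `v⁻¹ • V ⊆ V * V ⊆ U`.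
  obtain ⟨_, hy, _, ⟨v, hv, rfl⟩, rfl⟩ :=
    mem_closure_iff.1 (interior_subset hz) _ isOpen_interior hz
  have := smul_mem_interior_closure_image_smul (s • v)⁻¹ hy
  simp only [inv_smul_smul] at this
  refine interior_mono (closure_mono (image_mono ?_)) this
  rintro _ ⟨_, ⟨w, hw, rfl⟩, rfl⟩
  refine hVU ?_
  have : (s • v)⁻¹ • s • w = v⁻¹ * w := by simp [smul_eq_mul, mul_assoc]
  simp only [this]
  exact mul_mem_mul (by rw [← hVs]; exact inv_mem_inv.2 hv) hw

/-- A regular first-countable Baire space with a continuous transitive action of an `ω`-narrow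
group is second countable. -/
theorem IsOmegaNarrow.secondCountableTopology (hG : IsOmegaNarrow G) [BaireSpace X]
    [RegularSpace X] [FirstCountableTopology X] [MulAction.IsPretransitive G X] :
    SecondCountableTopology X := by
  cases isEmpty_or_nonempty X
  · infer_instance
  obtain ⟨x⟩ := ‹Nonempty X›
  obtain ⟨O, hO⟩ := (𝓝 x).exists_antitone_basis
  have hU (n : ℕ) : ∃ V ∈ 𝓝 (1 : G), IsClosed V ∧ V⁻¹ = V ∧
      V * V ⊆ (· • x) ⁻¹' O n := by
    refine exists_closed_nhds_one_inv_eq_mul_subset ?_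
    have : Continuous fun g : G ↦ g • x := by fun_prop
    exact this.continuousAt.preimage_mem_nhds (by simpa using hO.mem n)
  choose V hV _ hVs hVO using hU
  have hW (n : ℕ) := exists_closed_nhds_one_inv_eq_mul_subset (hV n)
  choose W hW _ hWs hWV using hW
  choose S hSc hS using fun n ↦ hG (W n) (hW n)
  have hWsub (n : ℕ) : W n ⊆ V n := fun w hw ↦
    hWV n ⟨w, hw, 1, mem_of_mem_nhds (hW n), by simp⟩
  -- The translates of the smaller `W n` cover `G`, but the sets use `V n`. For `g = s * w`, this
  -- slack gives `g • W n ⊆ s • V n`, so the set contains `g • x`; also `s • V n ⊆ g • (V n * V n)`,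
  -- so it is small.
  let B : Set (Set X) := ⋃ n, (fun s ↦ interior (closure ((· • x) '' (s • V n)))) '' S n
  have hB : IsTopologicalBasis B := by
    refine isTopologicalBasis_of_isOpen_of_nhds ?_ ?_
    · rintro _ hu
      obtain ⟨n, s, -, rfl⟩ := mem_iUnion.1 hu
      exact isOpen_interior
    · intro y N hy hN
      obtain ⟨g, rfl⟩ := MulAction.exists_smul_eq G x y
      -- Members of `B` involve closures, so regularity is used to fit a closed neighbourhood inside
      -- `N`.
      obtain ⟨C, ⟨hC, hCc⟩, hCN⟩ := (closed_nhds_basis (g • x)).mem_iff.1 (hN.mem_nhds hy)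
      have hC' : g⁻¹ • C ∈ 𝓝 x := by
        rwa [← smul_mem_nhds_smul_iff g, smul_inv_smul]
      obtain ⟨n, hn⟩ := hO.mem_iff.1 hC'
      obtain ⟨s, hs, w, hw, hg⟩ : g ∈ S n * W n := hS n ▸ mem_univ g
      refine ⟨_, mem_iUnion.2 ⟨n, s, hs, rfl⟩, ?_, ?_⟩
      · have := smul_mem_interior_closure_image_smul g
          (hG.mem_interior_closure_image_smul (hW n) x)
        refine interior_mono (closure_mono (image_mono ?_)) this
        rintro _ ⟨v, hv, rfl⟩
        refine ⟨w * v, hWV n (mul_mem_mul hw hv), ?_⟩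
        simp [← hg, mul_assoc]
      · refine (interior_subset.trans (closure_minimal ?_ hCc)).trans hCN
        rintro _ ⟨_, ⟨v, hv, rfl⟩, rfl⟩
        have h1 : (w⁻¹ * v) • x ∈ O n := hVO n <| mul_mem_mul
          (by rw [← hVs]; exact inv_mem_inv.2 (hWsub n hw)) hv
        have h2 := hn h1
        rw [mem_inv_smul_set_iff, smul_smul, ← hg] at h2
        simpa [mul_assoc] using h2
  exact hB.secondCountableTopology (countable_iUnion fun n ↦ (hSc n).image _)

end NearlyOpen

theorem AdmitsNarrowTransitiveAction.secondCountableTopology {X : Type u} [TopologicalSpace X]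
    [BaireSpace X] [RegularSpace X] [FirstCountableTopology X]
    (h : AdmitsNarrowTransitiveAction.{u, v} X) : SecondCountableTopology X := by
  obtain ⟨G, _, _, _, _, hG, _, _⟩ := h
  exact hG.secondCountableTopology

/-- The Baire property lifts along a continuous surjection all of whose saturated open sets form
a `π`-base. -/
theorem BaireSpace.of_surjective {X Y : Type*} [TopologicalSpace X] [TopologicalSpace Y]
    [BaireSpace Y] {p : X → Y} (hp : Continuous p) (hs : Function.Surjective p)
    (h : ∀ O : Set X, IsOpen O → O.Nonempty → ∃ V : Set Y, IsOpen V ∧ V.Nonempty ∧ p ⁻¹' V ⊆ O) :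
    BaireSpace X := by
  refine ⟨fun f hfo hfd ↦ ?_⟩
  -- The largest open set of `Y` whose preimage lies in `f n`; the hypothesis `h` makes it dense.
  let g (n : ℕ) : Set Y := ⋃₀ {V | IsOpen V ∧ p ⁻¹' V ⊆ f n}
  have hgo (n : ℕ) : IsOpen (g n) := isOpen_sUnion fun V hV ↦ hV.1
  have hgd (n : ℕ) : Dense (g n) := by
    refine dense_iff_inter_open.2 fun W hW hWne ↦ ?_
    obtain ⟨V, hV, ⟨y, hy⟩, hVW⟩ := h _ ((hW.preimage hp).inter (hfo n))
      ((hfd n).inter_open_nonempty _ (hW.preimage hp) (hWne.preimage hs))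
    obtain ⟨x, rfl⟩ := hs y
    exact ⟨p x, (hVW hy).1, V, ⟨hV, fun z hz ↦ (hVW hz).2⟩, hy⟩
  refine dense_iff_inter_open.2 fun O hO hOne ↦ ?_
  obtain ⟨V, hV, hVne, hVO⟩ := h O hO hOne
  obtain ⟨y, hyV, hy⟩ := (dense_iInter_of_isOpen_nat hgo hgd).inter_open_nonempty V hV hVne
  obtain ⟨x, rfl⟩ := hs y
  refine ⟨x, hVO hyV, mem_iInter.2 fun n ↦ ?_⟩
  obtain ⟨V', hV', hx⟩ := mem_iInter.1 hy n
  exact hV'.2 hx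

/-! ### From nearly open actions to open orbit maps and coset spaces. -/

section OpenMapping

variable {G X : Type*} [Group G] [TopologicalSpace G] [IsTopologicalGroup G]
  [MetricSpace X] [MulAction G X] [ContinuousSMul G X]

/-- Open mapping principle: a nearly open continuous action of a completely metrizable group on
a metric space has open orbit maps. -/
theorem image_smul_mem_nhds_of_nearlyOpen [IsCompletelyMetrizableSpace G]
    (hno : ∀ U ∈ 𝓝 (1 : G), ∀ x : X, x ∈ interior (closure ((· • x) '' U)))
    {U : Set G} (hU : U ∈ 𝓝 1) (x : X) : (· • x) '' U ∈ 𝓝 x := by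
  let := upgradeIsCompletelyMetrizable G
  obtain ⟨V, hV, -, hVs, hVU⟩ := exists_closed_nhds_one_inv_eq_mul_subset hU
  obtain ⟨ε, hε, hεV⟩ := Metric.nhds_basis_closedBall.mem_iff.1 hV
  -- These radii sum to `ε`, so sequences starting at `1` with steps at most `r n` converge within
  -- the closed `ε`-ball, hence in `V`.
  let r (n : ℕ) : ℝ := ε / 2 / 2 ^ n
  have hr (n : ℕ) : 0 < r n := by positivity
  have hball (b : G) (n : ℕ) (z : X) :
      b • z ∈ interior (closure ((· • z) '' Metric.ball b (r n))) := by
    have hb : b⁻¹ • Metric.ball b (r n) ∈ 𝓝 (1 : G) := by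
      rw [← smul_mem_nhds_smul_iff b, smul_inv_smul]
      simpa using Metric.ball_mem_nhds b (hr n)
    simpa using smul_mem_interior_closure_image_smul b (hno _ hb z)
  refine Filter.mem_of_superset (isOpen_interior.mem_nhds (by simpa using hball 1 0 x)) ?_
  intro y hy
  -- Back-and-forth: pairs `(a, b)` are built with `a • y` and `b • x` ever closer. In the limit `b'
  -- • x = a' • y`, so `y = (a'⁻¹ * b') • x`.
  let P (n : ℕ) (s : G × G) : Prop :=
    s.1 • y ∈ interior (closure ((· • x) '' Metric.ball s.2 (r n)))
  have step (n : ℕ) (s : G × G) (hs : P n s) : ∃ t : G × G, P (n + 1) t ∧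
      dist s.1 t.1 ≤ r n ∧ dist s.2 t.2 ≤ r n ∧ dist (t.2 • x) (s.1 • y) ≤ r n := by
    obtain ⟨a, b⟩ := s
    -- First `b` moves, bringing `b' • x` close to `a • y` and into the region approximable by the
    -- orbit of `y`; then `a` moves, restoring the invariant at the next radius.
    obtain ⟨_, ⟨h1, h2⟩, b', hb', rfl⟩ := mem_closure_iff.1 (interior_subset hs) _
      (isOpen_interior.inter Metric.isOpen_ball)
      ⟨hball a n y, Metric.mem_ball_self (x := a • y) (hr n)⟩
    obtain ⟨_, h3, a', ha', rfl⟩ := mem_closure_iff.1 (interior_subset h1) _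
      isOpen_interior (hball b' (n + 1) x)
    exact ⟨(a', b'), h3, (Metric.mem_ball'.1 ha').le, (Metric.mem_ball'.1 hb').le,
      (Metric.mem_ball.1 h2).le⟩
  choose F hFP hF1 hF2 hF3 using step
  let s : ∀ n, {s // P n s} := fun n ↦
    Nat.rec ⟨((1 : G), (1 : G)), by simpa [P] using hy⟩
      (fun n t ↦ ⟨F n t.1 t.2, hFP n t.1 t.2⟩) n
  let a (n : ℕ) : G := (s n).1.1
  let b (n : ℕ) : G := (s n).1.2
  have ha (n : ℕ) : dist (a n) (a (n + 1)) ≤ r n := hF1 n _ (s n).2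
  have hb (n : ℕ) : dist (b n) (b (n + 1)) ≤ r n := hF2 n _ (s n).2
  have hab (n : ℕ) : dist (b (n + 1) • x) (a n • y) ≤ r n := hF3 n _ (s n).2
  obtain ⟨a', ha'⟩ := cauchySeq_tendsto_of_complete (cauchySeq_of_le_geometric_two ha)
  obtain ⟨b', hb'⟩ := cauchySeq_tendsto_of_complete (cauchySeq_of_le_geometric_two hb)
  have ha0 : a' ∈ V := hεV <| Metric.mem_closedBall'.2 <|
    dist_le_of_le_geometric_two_of_tendsto₀ ha ha'
  have hb0 : b' ∈ V := hεV <| Metric.mem_closedBall'.2 <|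
    dist_le_of_le_geometric_two_of_tendsto₀ hb hb'
  have hr0 : Filter.Tendsto r Filter.atTop (𝓝 0) := by
    have := (tendsto_pow_atTop_nhds_zero_of_lt_one (r := (1 / 2 : ℝ)) (by norm_num)
      (by norm_num)).const_mul (ε / 2)
    simpa [r, div_eq_mul_inv] using this
  have hlim : Filter.Tendsto (fun n ↦ dist (b (n + 1) • x) (a n • y)) Filter.atTop
      (𝓝 (dist (b' • x) (a' • y))) :=
    (((Filter.tendsto_add_atTop_iff_nat 1).2 hb').smul_const x).dist (ha'.smul_const y)
  have heq : b' • x = a' • y := dist_le_zero.1 (le_of_tendsto_of_tendsto' hlim hr0 hab)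
  refine ⟨a'⁻¹ * b', hVU (mul_mem_mul (by rw [← hVs]; exact inv_mem_inv.2 ha0) hb0), ?_⟩
  simp [mul_smul, heq]

/-- If orbit maps of a continuous transitive action are open at the identity, then the space is
a quotient of the group. -/
theorem nonempty_homeomorph_quotient_stabilizer [MulAction.IsPretransitive G X] (x : X)
    (h : ∀ U ∈ 𝓝 (1 : G), (· • x) '' U ∈ 𝓝 x) :
    Nonempty (X ≃ₜ G ⧸ MulAction.stabilizer G x) := by
  have hcont : Continuous fun g : G ↦ g • x := by fun_prop
  have hopen : IsOpenMap fun g : G ↦ g • x := by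
    refine isOpenMap_iff_nhds_le.2 fun g ↦ Filter.le_map fun U hU ↦ ?_
    have hU' : g⁻¹ • U ∈ 𝓝 (1 : G) := by
      rw [← smul_mem_nhds_smul_iff g, smul_inv_smul]
      simpa using hU
    have := (smul_mem_nhds_smul_iff g).2 (h _ hU')
    refine Filter.mem_of_superset this ?_
    rintro _ ⟨_, ⟨_, ⟨u, hu, rfl⟩, rfl⟩, rfl⟩
    exact ⟨u, hu, by simp [smul_smul]⟩
  have hq : IsQuotientMap fun g : G ↦ g • x :=
    hopen.isQuotientMap hcont (MulAction.surjective_smul G x)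
  have hsurj : Function.Surjective (MulAction.ofQuotientStabilizer G x) := fun y ↦
    (MulAction.exists_smul_eq G x y).imp' ((↑) : G → G ⧸ MulAction.stabilizer G x) fun _ h ↦ h
  let e := Equiv.ofBijective _ ⟨MulAction.injective_ofQuotientStabilizer G x, hsurj⟩
  have he : e.symm ∘ (fun g : G ↦ g • x) = ((↑) : G → G ⧸ MulAction.stabilizer G x) :=
    funext fun g ↦ e.symm_apply_apply g
  exact ⟨{ e.symm with
    continuous_toFun := hq.continuous_iff.2 (he ▸ QuotientGroup.continuous_mk)
    continuous_invFun := (QuotientGroup.isQuotientMap_mk _).continuous_iff.2 hcont }⟩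

end OpenMapping

/-! ### The Polish homeomorphism group of a compact metrizable space. -/

theorem isOmegaNarrow_of_separableSpace (G : Type*) [Group G] [TopologicalSpace G]
    [IsTopologicalGroup G] [SeparableSpace G] : IsOmegaNarrow G := by
  intro U hU
  obtain ⟨S, hSc, hSd⟩ := exists_countable_dense G
  refine ⟨S, hSc, eq_univ_iff_forall.2 fun g ↦ ?_⟩
  -- The inverse appears because `g ∈ s • U` is equivalent to `s ∈ g • U⁻¹`.
  have hU' : g • U⁻¹ ∈ 𝓝 g := by
    simpa using (smul_mem_nhds_smul_iff (a := (1 : G)) g).2 (inv_mem_nhds_one G hU)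
  obtain ⟨s, ⟨u, hu, rfl⟩, hs⟩ := mem_closure_iff_nhds.1 (hSd g) _ hU'
  exact ⟨_, hs, u⁻¹, hu, by simp⟩

/-- The monoid of continuous self-maps of a space under composition, with the compact-open
topology. -/
def ContinuousEnd (X : Type u) [TopologicalSpace X] : Type u := C(X, X)

namespace ContinuousEnd

variable {X : Type u} [TopologicalSpace X]

instance : TopologicalSpace (ContinuousEnd X) := inferInstanceAs (TopologicalSpace C(X, X))

instance : Monoid (ContinuousEnd X) where
  one := ContinuousMap.id X
  mul f g := ContinuousMap.comp f g
  mul_assoc _ _ _ := rfl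
  one_mul _ := rfl
  mul_one _ := rfl

instance : MulAction (ContinuousEnd X) X where
  smul f x := ContinuousMap.toFun f x
  one_smul _ := rfl
  mul_smul _ _ _ := rfl

instance [LocallyCompactSpace X] : ContinuousMul (ContinuousEnd X) where
  continuous_mul := ContinuousMap.continuous_comp'.comp continuous_swap

instance [LocallyCompactSpace X] : ContinuousSMul (ContinuousEnd X) X where
  continuous_smul := continuous_eval (F := C(X, X))

instance [LocallyCompactSpace X] : ContinuousSMul (ContinuousEnd X)ˣ X where
  continuous_smul := by
    have : Continuous fun p : (ContinuousEnd X)ˣ × X ↦ (p.1 : ContinuousEnd X) • p.2 :=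
      (Units.continuous_val.comp continuous_fst).smul continuous_snd
    exact this

/-- A homeomorphism as a unit of the monoid of continuous self-maps. -/
def unitOfHomeomorph (h : X ≃ₜ X) : (ContinuousEnd X)ˣ where
  val := (h : C(X, X))
  inv := (h.symm : C(X, X))
  val_inv := ContinuousMap.ext h.apply_symm_apply
  inv_val := ContinuousMap.ext h.symm_apply_apply

theorem isPretransitive_units (hX : IsHomogeneousSpace X) :
    MulAction.IsPretransitive (ContinuousEnd X)ˣ X :=
  ⟨fun x y ↦ (hX x y).imp' unitOfHomeomorph fun _ h ↦ h⟩

end ContinuousEnd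

/-- The image is cut out by the closed conditions `a * b = 1` and `b * a = 1`. It transfers complete
metrizability and second countability from the monoid to its units. -/
theorem Units.isClosedEmbedding_val_inv (M : Type*) [Monoid M] [TopologicalSpace M]
    [ContinuousMul M] [T2Space M] :
    IsClosedEmbedding fun u : Mˣ ↦ ((u : M), ((u⁻¹ : Mˣ) : M)) := by
  refine ⟨((Homeomorph.refl M).prodCongr
    MulOpposite.opHomeomorph.symm).isEmbedding.comp Units.isEmbedding_embedProduct, ?_⟩
  have : range (fun u : Mˣ ↦ ((u : M), ((u⁻¹ : Mˣ) : M))) =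
      {p | p.1 * p.2 = 1} ∩ {p | p.2 * p.1 = 1} := by
    ext ⟨a, b⟩
    constructor
    · rintro ⟨u, hu⟩
      simp only [Prod.mk.injEq] at hu
      obtain ⟨rfl, rfl⟩ := hu
      simp
    · rintro ⟨h1, h2⟩
      exact ⟨⟨a, b, h1, h2⟩, rfl⟩
  rw [this]
  exact (isClosed_eq (by fun_prop) (by fun_prop)).inter (isClosed_eq (by fun_prop) (by fun_prop))

/-- A homogeneous compact metrizable space is a coset space of its homeomorphism group. -/
theorem IsHomogeneousSpace.isCosetSpace {X : Type u} [TopologicalSpace X] [CompactSpace X]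
    [MetrizableSpace X] [Nonempty X] (hX : IsHomogeneousSpace X) : IsCosetSpace X := by
  let := metrizableSpaceMetric X
  have : IsCompletelyMetrizableSpace (ContinuousEnd X) :=
    inferInstanceAs (IsCompletelyMetrizableSpace C(X, X))
  have : SecondCountableTopology (ContinuousEnd X) :=
    inferInstanceAs (SecondCountableTopology C(X, X))
  have hemb := Units.isClosedEmbedding_val_inv (ContinuousEnd X)
  have := hemb.IsCompletelyMetrizableSpace
  have := hemb.isEmbedding.secondCountableTopology
  have := ContinuousEnd.isPretransitive_units hX
  have hG := isOmegaNarrow_of_separableSpace (ContinuousEnd X)ˣ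
  obtain ⟨x⟩ := ‹Nonempty X›
  exact ⟨(ContinuousEnd X)ˣ, inferInstance, inferInstance, inferInstance,
    MulAction.stabilizer _ x, nonempty_homeomorph_quotient_stabilizer x fun U hU ↦
      image_smul_mem_nhds_of_nearlyOpen
        (fun U hU z ↦ hG.mem_interior_closure_image_smul hU z) hU x⟩

/-! ### The Sorgenfrey line. -/

namespace SorgenfreyLine

/-- The identity map from the Sorgenfrey line to the real line. -/
def toReal (x : SorgenfreyLine) : ℝ := x

theorem toReal_injective : Function.Injective toReal := fun _ _ h ↦ h

theorem isOpen_Ico (a b : ℝ) : IsOpen (toReal ⁻¹' Ico a b) :=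
  isOpen_generateFrom_of_mem ⟨a, b, rfl⟩

theorem nhds_hasBasis (x : SorgenfreyLine) :
    (𝓝 x).HasBasis (fun b : ℝ ↦ toReal x < b) fun b ↦ toReal ⁻¹' Ico (toReal x) b := by
  refine ⟨fun s ↦ ⟨fun hs ↦ ?_, fun ⟨b, hb, hbs⟩ ↦
    Filter.mem_of_superset ((isOpen_Ico _ b).mem_nhds ⟨le_rfl, hb⟩) hbs⟩⟩
  have key : Filter.comap toReal (𝓝[≥] (toReal x)) ≤ 𝓝 x := by
    rw [nhds_generateFrom]
    refine le_iInf₂ fun t ⟨hxt, a, b, htab⟩ ↦ Filter.le_principal_iff.2 ?_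
    subst htab
    have hx : toReal x ∈ Ico a b := hxt
    refine Filter.mem_comap.2 ⟨_, Ico_mem_nhdsGE hx.2, fun y hy ↦ ?_⟩
    exact ⟨hx.1.trans hy.1, hy.2⟩
  obtain ⟨t, ht, hts⟩ := Filter.mem_comap.1 (key hs)
  obtain ⟨b, hb, hbt⟩ := (nhdsGE_basis (toReal x)).mem_iff.1 ht
  exact ⟨b, hb, (preimage_mono hbt).trans hts⟩

theorem continuous_toReal : Continuous toReal := by
  refine continuous_iff_continuousAt.2 fun x ↦ ?_
  refine (Filter.HasBasis.tendsto_right_iff (nhds_basis_Ioo (toReal x))).2 fun ⟨a, b⟩ hab ↦ ?_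
  exact Filter.mem_of_superset ((nhds_hasBasis x).mem_of_mem hab.2)
    fun y hy ↦ ⟨hab.1.trans_le hy.1, hy.2⟩

theorem isClosed_Ico (a b : ℝ) : IsClosed (toReal ⁻¹' Ico a b) := by
  refine ⟨isOpen_iff_mem_nhds.2 fun x hx ↦ ?_⟩
  rcases lt_or_ge (toReal x) a with h | h
  · exact Filter.mem_of_superset ((nhds_hasBasis x).mem_of_mem h)
      fun y hy hy' ↦ (hy.2.trans_le hy'.1).false
  · refine Filter.mem_of_superset ((nhds_hasBasis x).mem_of_mem (lt_add_one _))
      fun y hy hy' ↦ hx ⟨h, hy.1.trans_lt hy'.2⟩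

instance : RegularSpace SorgenfreyLine :=
  RegularSpace.of_hasBasis nhds_hasBasis fun _ _ _ ↦ isClosed_Ico _ _

instance : FirstCountableTopology SorgenfreyLine := by
  refine ⟨fun x ↦ ?_⟩
  have : 𝓝 x = Filter.comap toReal (𝓝[≥] (toReal x)) :=
    (nhds_hasBasis x).eq_of_same_basis ((nhdsGE_basis _).comap toReal)
  rw [this]
  infer_instance

instance : BaireSpace SorgenfreyLine := by
  refine BaireSpace.of_surjective continuous_toReal (fun x ↦ ⟨x, rfl⟩) fun O hO ⟨x, hx⟩ ↦ ?_
  obtain ⟨b, hb, hbO⟩ := (nhds_hasBasis x).mem_iff.1 (hO.mem_nhds hx)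
  exact ⟨Ioo (toReal x) b, isOpen_Ioo, nonempty_Ioo.2 hb,
    fun y hy ↦ hbO ⟨hy.1.le, hy.2⟩⟩

/-- A basic set containing `x` and contained in `[x, x + 1)` has minimum `x`, so distinct points
need distinct basic sets. -/
theorem not_secondCountableTopology : ¬ SecondCountableTopology SorgenfreyLine := by
  intro
  have h (x : SorgenfreyLine) : ∃ U ∈ countableBasis SorgenfreyLine, x ∈ U ∧
      U ⊆ toReal ⁻¹' Ico (toReal x) (toReal x + 1) :=
    (isBasis_countableBasis _).exists_subset_of_mem_open ⟨le_rfl, lt_add_one _⟩ (isOpen_Ico _ _)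
  choose U hUB hxU hU using h
  have hinj : Function.Injective fun x ↦ (⟨U x, hUB x⟩ : countableBasis SorgenfreyLine) := by
    intro x y hxy
    have hxy : U x = U y := congrArg Subtype.val hxy
    exact toReal_injective (le_antisymm (hU x (hxy ▸ hxU y)).1 (hU y (hxy ▸ hxU x)).1)
  have : Countable (countableBasis SorgenfreyLine) := (countable_countableBasis _).to_subtype
  have : Countable ℝ := hinj.countable
  exact Cardinal.not_countable_real countable_univ

end SorgenfreyLine

/-! ### The two-arrows space. -/

namespace TwoArrows

instance : OrderTopology TwoArrows := ⟨rfl⟩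

/-- The first coordinate of a point of the two-arrows space. -/
def fst (p : TwoArrows) : ℝ := (ofLex p.1).1

/-- The second coordinate of a point of the two-arrows space. -/
def snd (p : TwoArrows) : Bool := (ofLex p.1).2

theorem lt_iff {p q : TwoArrows} : p < q ↔ p.fst < q.fst ∨ p.fst = q.fst ∧ p.snd < q.snd :=
  Prod.Lex.lt_iff

theorem lt_of_fst_lt {p q : TwoArrows} (h : p.fst < q.fst) : p < q := lt_iff.2 (.inl h)

theorem fst_mem (p : TwoArrows) : p.fst ∈ Icc (0 : ℝ) 1 := by
  rcases p.2 with ⟨-, h0, h1⟩ | ⟨-, h0, h1⟩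
  · exact ⟨h0.le, h1⟩
  · exact ⟨h0, h1.le⟩

theorem fst_le {p q : TwoArrows} (h : p ≤ q) : p.fst ≤ q.fst := by
  rcases h.eq_or_lt with rfl | h
  · rfl
  · rcases lt_iff.1 h with h | h
    exacts [h.le, h.1.le]

/-- The point `(x, 0)`. -/
def lower (x : ℝ) (h0 : 0 < x) (h1 : x ≤ 1) : TwoArrows := ⟨toLex (x, false), .inl ⟨rfl, h0, h1⟩⟩

/-- The point `(x, 1)`. -/
def upper (x : ℝ) (h0 : 0 ≤ x) (h1 : x < 1) : TwoArrows := ⟨toLex (x, true), .inr ⟨rfl, h0, h1⟩⟩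

theorem eq_lower_or_upper (p : TwoArrows) :
    (∃ x h0 h1, p = lower x h0 h1) ∨ ∃ x h0 h1, p = upper x h0 h1 := by
  obtain ⟨⟨x, i⟩, ⟨h, h0, h1⟩ | ⟨h, h0, h1⟩⟩ := p
  · obtain rfl : i = false := h
    exact .inl ⟨x, h0, h1, rfl⟩
  · obtain rfl : i = true := h
    exact .inr ⟨x, h0, h1, rfl⟩

theorem lower_covBy_upper {x : ℝ} (h0 : 0 < x) (h1 : x < 1) :
    lower x h0 h1.le ⋖ upper x h0.le h1 := by
  refine ⟨lt_iff.2 (.inr ⟨rfl, rfl⟩), fun q h h' ↦ ?_⟩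
  rcases lt_iff.1 h with h2 | ⟨h2, h3⟩
  · exact (fst_le h'.le).not_gt h2
  · rcases lt_iff.1 h' with h4 | ⟨-, h5⟩
    · exact h4.ne h2.symm
    · revert h3 h5
      change false < q.snd → q.snd < true → False
      cases q.snd <;> decide

theorem continuous_fst : Continuous fst := by
  refine continuous_iff_continuousAt.2 fun p ↦ tendsto_order.2 ⟨fun a ha ↦ ?_, fun a ha ↦ ?_⟩
  · rcases lt_or_ge a 0 with h | h
    · exact Filter.Eventually.of_forall fun q ↦ h.trans_le (fst_mem q).1
    · obtain ⟨z, hz⟩ := exists_between ha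
      have hlt : lower z (h.trans_lt hz.1) (hz.2.le.trans (fst_mem p).2) < p :=
        lt_of_fst_lt hz.2
      refine Filter.mem_of_superset (Ioi_mem_nhds hlt) fun q hq ↦ ?_
      exact hz.1.trans_le (fst_le (le_of_lt hq))
  · rcases lt_or_ge 1 a with h | h
    · exact Filter.Eventually.of_forall fun q ↦ (fst_mem q).2.trans_lt h
    · obtain ⟨z, hz⟩ := exists_between ha
      have hlt : p < upper z ((fst_mem p).1.trans hz.1.le) (hz.2.trans_le h) :=
        lt_of_fst_lt hz.1
      refine Filter.mem_of_superset (Iio_mem_nhds hlt) fun q hq ↦ ?_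
      exact (fst_le (le_of_lt hq)).trans_lt hz.2

/-- Neighbourhoods are one-sided: the ray from `(x, 1)` upwards is open, because `(x, 0)` is its
immediate predecessor, or because the ray is everything when `x = 0`. -/
theorem nhds_upper {x : ℝ} (h0 : 0 ≤ x) (h1 : x < 1) :
    𝓝 (upper x h0 h1) =
      Filter.comap fst (𝓝 x) ⊓ Filter.principal (Ici (upper x h0 h1)) := by
  refine le_antisymm (le_inf continuous_fst.continuousAt.le_comap ?_) ?_
  · refine Filter.le_principal_iff.2 ?_
    rcases h0.eq_or_lt with rfl | h0
    · refine Filter.univ_mem' fun q ↦ ?_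
      refine le_of_not_gt (α := TwoArrows) fun hq ↦ ?_
      rcases lt_iff.1 hq with h | ⟨h, -⟩
      · exact (fst_mem q).1.not_gt h
      · rcases eq_lower_or_upper q with ⟨y, hy, hy1, rfl⟩ | ⟨y, hy, hy1, rfl⟩
        · exact hy.ne' h
        · obtain rfl : y = 0 := h
          exact lt_irrefl _ hq
    · rw [← (lower_covBy_upper h0 h1).Ioi_eq]
      exact Ioi_mem_nhds (lower_covBy_upper h0 h1).lt
  · rw [nhds_eq_order (upper x h0 h1)]
    refine le_inf ?_ ?_ <;> refine le_iInf₂ fun b hb ↦ ?_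
    · exact inf_le_right.trans (Filter.principal_mono.2 fun q hq ↦ mem_Ioi.2 (lt_of_lt_of_le hb hq))
    · refine inf_le_left.trans (Filter.le_principal_iff.2 ?_)
      have hb' : x < b.fst := by
        rcases lt_iff.1 hb with h | ⟨-, h⟩
        · exact h
        · exact absurd h (not_lt.2 le_top)
      exact Filter.mem_comap.2 ⟨_, Iio_mem_nhds hb', fun q hq ↦ lt_of_fst_lt hq⟩

theorem nhds_lower {x : ℝ} (h0 : 0 < x) (h1 : x ≤ 1) :
    𝓝 (lower x h0 h1) =
      Filter.comap fst (𝓝 x) ⊓ Filter.principal (Iic (lower x h0 h1)) := by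
  refine le_antisymm (le_inf continuous_fst.continuousAt.le_comap ?_) ?_
  · refine Filter.le_principal_iff.2 ?_
    rcases h1.eq_or_lt with rfl | h1
    · refine Filter.univ_mem' fun q ↦ ?_
      refine le_of_not_gt (α := TwoArrows) fun hq ↦ ?_
      rcases lt_iff.1 hq with h | ⟨h, -⟩
      · exact (fst_mem q).2.not_gt h
      · rcases eq_lower_or_upper q with ⟨y, hy0, hy, rfl⟩ | ⟨y, hy0, hy, rfl⟩
        · obtain rfl : y = 1 := h.symm
          exact lt_irrefl _ hq
        · exact hy.ne' h
    · rw [← (lower_covBy_upper h0 h1).Iio_eq]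
      exact Iio_mem_nhds (lower_covBy_upper h0 h1).lt
  · rw [nhds_eq_order (lower x h0 h1)]
    refine le_inf ?_ ?_ <;> refine le_iInf₂ fun b hb ↦ ?_
    · refine inf_le_left.trans (Filter.le_principal_iff.2 ?_)
      have hb' : b.fst < x := by
        rcases lt_iff.1 hb with h | ⟨-, h⟩
        · exact h
        · exact absurd h (not_lt.2 bot_le)
      exact Filter.mem_comap.2 ⟨_, Ioi_mem_nhds hb', fun q hq ↦ lt_of_fst_lt hq⟩
    · exact inf_le_right.trans (Filter.principal_mono.2 fun q hq ↦ mem_Iio.2 (lt_of_le_of_lt hq hb))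

instance : FirstCountableTopology TwoArrows := by
  refine ⟨fun p ↦ ?_⟩
  rcases eq_lower_or_upper p with ⟨x, h0, h1, rfl⟩ | ⟨x, h0, h1, rfl⟩
  · rw [nhds_lower]
    infer_instance
  · rw [nhds_upper]
    infer_instance

/-- An open set contains a one-sided neighbourhood of each of its points, hence everything over some
real interval. This lets the Baire property of `[0, 1]` lift along `fst`. -/
theorem exists_Ioo_subset {O : Set TwoArrows} (hO : IsOpen O) (hne : O.Nonempty) :
    ∃ a b : ℝ, 0 ≤ a ∧ a < b ∧ b ≤ 1 ∧ fst ⁻¹' Ioo a b ⊆ O := by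
  obtain ⟨p, hp⟩ := hne
  have hp := hO.mem_nhds hp
  rcases eq_lower_or_upper p with ⟨x, h0, h1, rfl⟩ | ⟨x, h0, h1, rfl⟩
  · rw [nhds_lower, Filter.mem_inf_principal, Filter.mem_comap] at hp
    obtain ⟨t, ht, hts⟩ := hp
    obtain ⟨l, hl, hlt⟩ := exists_Ioc_subset_of_mem_nhds ht ⟨0, h0⟩
    exact ⟨max l 0, x, le_max_right _ _, max_lt hl h0, h1, fun q hq ↦
      hts (hlt ⟨(le_max_left _ _).trans_lt hq.1, hq.2.le⟩) (lt_of_fst_lt (q := lower x h0 h1) hq.2).le⟩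
  · rw [nhds_upper, Filter.mem_inf_principal, Filter.mem_comap] at hp
    obtain ⟨t, ht, hts⟩ := hp
    obtain ⟨u, hu, hut⟩ := exists_Ico_subset_of_mem_nhds ht ⟨1, h1⟩
    exact ⟨x, min u 1, h0, lt_min hu h1, min_le_right _ _, fun q hq ↦
      hts (hut ⟨hq.1.le, hq.2.trans_le (min_le_left _ _)⟩) (lt_of_fst_lt (p := upper x h0 h1) hq.1).le⟩

instance : BaireSpace TwoArrows := by
  refine BaireSpace.of_surjective (p := fun p ↦ (⟨p.fst, fst_mem p⟩ : Icc (0 : ℝ) 1))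
    (continuous_fst.subtype_mk _) (fun ⟨x, h0, h1⟩ ↦ ?_) fun O hO hne ↦ ?_
  · rcases h1.eq_or_lt with rfl | h
    · exact ⟨lower 1 one_pos le_rfl, rfl⟩
    · exact ⟨upper x h0 h, rfl⟩
  · obtain ⟨a, b, ha, hab, hb, h⟩ := exists_Ioo_subset hO hne
    obtain ⟨z, hz⟩ := exists_between hab
    exact ⟨Subtype.val ⁻¹' Ioo a b, isOpen_Ioo.preimage continuous_subtype_val,
      ⟨⟨z, ha.trans hz.1.le, hz.2.le.trans hb⟩, hz⟩, h⟩

/-- A second-countable order topology has only countably many jumps, whereas here every `x` in `(0,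
1)` gives one. -/
theorem not_secondCountableTopology : ¬ SecondCountableTopology TwoArrows := by
  intro
  have hc : {p : TwoArrows | ∃ q, p ⋖ q}.Countable := countable_setOfPred_covBy_right
  have : (Ioo (0 : ℝ) 1).Countable := by
    refine (hc.image fst).mono fun x hx ↦ ?_
    exact ⟨lower x hx.1 hx.2.le, ⟨_, lower_covBy_upper hx.1 hx.2⟩, rfl⟩
  exact (Cardinal.Real.Ioo_countable_iff.1 this).not_gt one_pos

end TwoArrows

/-! ### The corollary. -/

theorem corollary4p11 :
    (∀ (X : Type u) [TopologicalSpace X] [T35Space X] [FirstCountableTopology X] [BaireSpace X],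
      IsHomogeneousSpace X → AdmitsNarrowTransitiveAction.{u, v} X →
        TopologicalSpace.SeparableSpace X ∧ TopologicalSpace.MetrizableSpace X) ∧
    ¬ AdmitsNarrowTransitiveAction.{0, v} SorgenfreyLine ∧
    ¬ AdmitsNarrowTransitiveAction.{0, v} TwoArrows ∧
    (∀ (X : Type u) [TopologicalSpace X] [CompactSpace X] [T2Space X] [FirstCountableTopology X]
      [Nonempty X],
      IsHomogeneousSpace X → ¬ IsCosetSpace X → ¬ AdmitsNarrowTransitiveAction.{u, v} X) := by
  refine ⟨?_, ?_, ?_, ?_⟩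
  · intro X _ _ _ _ _ h
    have := h.secondCountableTopology
    -- Metrizability is Urysohn's theorem for second-countable regular Hausdorff spaces.
    exact ⟨inferInstance, inferInstance⟩
  · exact fun h ↦ SorgenfreyLine.not_secondCountableTopology h.secondCountableTopology
  · exact fun h ↦ TwoArrows.not_secondCountableTopology h.secondCountableTopology
  · intro X _ _ _ _ _ hX hc h
    have := h.secondCountableTopology
    exact hc hX.isCosetSpace
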